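/- Let $\mathcal F_1$ be the class of probability densities $f$ on $\mathbb R$ (with respect to Lebesgue measure) such that: (i) $f(-z)=f(z)$ for all $z$ and $\int_{-\infty}^1 f(z)\,dz=3/4$; (ii) there is a locally integrable $\dot f$ with $f(z_2)-f(z_1)=\int_{z_1}^{z_2}\dot f(z)\,dz$ for all $z_1<z_2$; (iii) $\phi_f:=-\dot f/f$ is well defined on $\mathbb R$ (so that $f>0$) and monotone non-decreasing; (iv) $\mathcal K(f):=\int z^4\phi_f^2(z)f(z)\,dz<\infty$ (this implies that $\mathcal I(f):=\int\phi_f^2(z) f(z)\,dz$ and $\mathcal J(f):=\int z^2\phi_f^2(z)f(z)\,dz$ are finite); (v) for some $\beta>0$, $\int_y^\infty f(z)\,dz=O(y^{-\beta})$ as $y\to\infty$ and $\phi_f(z)=o(z^{\beta/2-2})$ as $z\to\infty$. Put $\kappa(f):=\mathcal J(f)/\mathcal I(f)$. Let $f_1\in\mathcal F_1$ and let $g_1\in\mathcal F_{f_1}:=\{g\in\mathcal F_1:\int z^4\phi_{f_1}^2(z)g(z)\,dz<\infty\}$. Put $$\mathcal I_{g_1}(f_1,g_1):=\int\phi_{f_1}(z)\phi_{g_1}(z)g_1(z)\,dz,\qquad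 \mathcal J_{g_1}(f_1,g_1):=\int z^2\phi_{f_1}(z)\phi_{g_1}(z)g_1(z)\,dz .$$ For $\theta\in\mathbb R$ and $\sigma>0$, let $\mathrm P^{(n)}_{\theta,\sigma,0;g_1}$ be the law under which $X_1,\dots,X_n$ are i.i.d. with density $x\mapsto\sigma^{-1}g_1((x-\theta)/\sigma)$, and let $$\Delta^{(n)}_{f_1;3}(\theta,\sigma,0):=n^{-1/2}\sum_{i=1}^n\phi_{f_1}(Z_i)\bigl(Z_i^2-\kappa(f_1)\bigr),\qquad Z_i:=\sigma^{-1}(X_i-\theta).$$ Then, for every $\theta\in\mathbb R$ and $\sigma>0$, under $\mathrm P^{(n)}_{\theta,\sigma,0;g_1}$, as $n\to\infty$: (i) for all $t\in\mathbb R$, $$\Delta_{f_1;3}^{(n)}(\theta+n^{-1/2}t,\sigma,0)=\Delta_{f_1;3}^{(n)}(\theta,\sigma,0)-t\,\sigma^{-1}\bigl(\mathcal J_{g_1}(f_1,g_1)-\kappa(f_1)\,\mathcal I_{g_1}(f_1,g_1)\bigr)+o_{\mathrm P}(1);$$ (ii) for all $s\in\mathbb R$, $$\Delta_{f_1;3}^{(n)}(\theta,\sigma+n^{-1/2}s,0)=\Delta_{f_1;3}^{(n)}(\theta,\sigma,0)+o_{\mathrm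 P}(1).$$ -/

import Mathlib

open Filter Topology MeasureTheory Asymptotics

namespace SymmetryTest

/-- The location score `φ_f = -f' / f` of a density `f` with derivative `fdot`. -/
noncomputable def score (f fdot : ℝ → ℝ) (z : ℝ) : ℝ := -fdot z / f z

/-- `MemF1 f fdot`: the function `f` belongs to the class `𝓕₁` of standardized symmetric, absolutely
continuous, strongly unimodal densities with finite information and polynomial tails, and `fdot`
is the (almost everywhere) derivative of `f` through which its score `-fdot / f` is formed.
Positivity of `f` is not a field: it follows from monotonicity of the score (see `MemF1.pos`). -/
structure MemF1 (f fdot : ℝ → ℝ) : Prop where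
  /-- `f` is a probability density with respect to Lebesgue measure. -/
  nonneg : ∀ z, 0 ≤ f z
  integrable : Integrable f
  integral_eq_one : ∫ z, f z = 1
  /-- (i) symmetry and standardization: the median of the absolute value is one. -/
  symm : ∀ z, f (-z) = f z
  standardized : ∫ z in Set.Iic (1 : ℝ), f z = 3 / 4
  /-- (ii) absolute continuity. -/
  intervalIntegrable : ∀ z₁ z₂, IntervalIntegrable fdot volume z₁ z₂
  sub_eq_integral : ∀ z₁ z₂, z₁ < z₂ → f z₂ - f z₁ = ∫ z in z₁..z₂, fdot z
  /-- (iii) strong unimodality. -/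
  monotone_score : Monotone (score f fdot)
  /-- (iv) `𝓚(f) < ∞`; finiteness of `𝓘(f)` and `𝓙(f)` is a consequence. -/
  integrable_infoK : Integrable (fun z => z ^ 4 * score f fdot z ^ 2 * f z)
  /-- (v) polynomial tails. -/
  tails : ∃ β : ℝ, 0 < β ∧
    ((fun y : ℝ => ∫ z in Set.Ioi y, f z) =O[atTop] fun y => y ^ (-β)) ∧
    (score f fdot =o[atTop] fun z => z ^ (β / 2 - 2))

/-- `MemFCross f fdot g gdot`: the density `g` belongs to `𝓕_f`, that is, `g` belongs to `𝓕₁` and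
`𝓚_g(f) = ∫ z⁴ φ_f² g` is finite. -/
structure MemFCross (f fdot g gdot : ℝ → ℝ) : Prop where
  memF1 : MemF1 g gdot
  integrable_infoK : Integrable (fun z => z ^ 4 * score f fdot z ^ 2 * g z)

/-- Information for location, `𝓘(f) = ∫ φ_f² f`. -/
noncomputable def infoI (f fdot : ℝ → ℝ) : ℝ := ∫ z, score f fdot z ^ 2 * f z

/-- Information for scale, `𝓙(f) = ∫ z² φ_f² f`. -/
noncomputable def infoJ (f fdot : ℝ → ℝ) : ℝ := ∫ z, z ^ 2 * score f fdot z ^ 2 * f z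

/-- Generalized kurtosis coefficient `κ(f) = 𝓙(f) / 𝓘(f)`. -/
noncomputable def kappa (f fdot : ℝ → ℝ) : ℝ := infoJ f fdot / infoI f fdot

/-- Cross-information `𝓘_g(f, g) = ∫ φ_f φ_g g`. -/
noncomputable def crossI (f fdot g gdot : ℝ → ℝ) : ℝ :=
  ∫ z, score f fdot z * score g gdot z * g z

/-- Cross-information `𝓙_g(f, g) = ∫ z² φ_f φ_g g`. -/
noncomputable def crossJ (f fdot g gdot : ℝ → ℝ) : ℝ :=
  ∫ z, z ^ 2 * score f fdot z * score g gdot z * g z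

/-- The law `P⁽ⁿ⁾_{θ,σ,0;g}` of an i.i.d. sample of size `n` with common density
`x ↦ σ⁻¹ g ((x - θ) / σ)`, the member of the Edgeworth family with skewness parameter `ξ = 0`. -/
noncomputable def nullLaw (n : ℕ) (θ σ : ℝ) (g : ℝ → ℝ) : Measure (Fin n → ℝ) :=
  Measure.pi fun _ =>
    (volume : Measure ℝ).withDensity fun x => ENNReal.ofReal (σ⁻¹ * g ((x - θ) / σ))

/-- Standardized observation `Z_i(θ, σ) = σ⁻¹ (x - θ)`. -/
noncomputable def stdObs (θ σ x : ℝ) : ℝ := σ⁻¹ * (x - θ)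

/-- Skewness component at `(θ, σ, 0)` of the central sequence:
`Δ_{f;3}⁽ⁿ⁾(θ, σ, 0) = n^{-1/2} ∑ᵢ φ_f(Zᵢ) (Zᵢ² - κ(f))`. -/
noncomputable def Delta3 (f fdot : ℝ → ℝ) (n : ℕ) (θ σ : ℝ) (x : Fin n → ℝ) : ℝ :=
  (√(n : ℝ))⁻¹ * ∑ i, score f fdot (stdObs θ σ (x i)) * (stdObs θ σ (x i) ^ 2 - kappa f fdot)

/-- `T n = o_P(1)` under the sequence of laws `P n`. -/
def IsLittleOP {Ω : ℕ → Type*} [∀ n, MeasurableSpace (Ω n)] (P : ∀ n, Measure (Ω n))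
    (T : ∀ n, Ω n → ℝ) : Prop :=
  ∀ ε : ℝ, 0 < ε → Tendsto (fun n => P n {ω | ε ≤ |T n ω|}) atTop (𝓝 0)

/-! Well-definedness: the densities are positive and the integrals above are finite. -/

theorem MemF1.continuous {f fdot : ℝ → ℝ} (h : MemF1 f fdot) : Continuous f := by
  have e : f = fun z => f 0 + ∫ u in (0 : ℝ)..z, fdot u := by
    funext z
    rcases lt_trichotomy 0 z with hz | hz | hz
    · linarith [h.sub_eq_integral 0 z hz]
    · simp [← hz]
    · rw [intervalIntegral.integral_symm]
      linarith [h.sub_eq_integral z 0 hz]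
  rw [e]
  exact continuous_const.add (intervalIntegral.continuous_primitive h.intervalIntegrable 0)

theorem MemF1.pos {f fdot : ℝ → ℝ} (h : MemF1 f fdot) (z : ℝ) : 0 < f z := by
  have hc := h.continuous
  -- if the score is nonnegative from a zero of `f` on, then `f` vanishes from there on
  have step : ∀ a, f a = 0 → (∀ z, a ≤ z → 0 ≤ score f fdot z) → ∀ w, a ≤ w → f w = 0 := by
    intro a ha hs w hw
    by_contra hne
    have hwp : 0 < f w := lt_of_le_of_ne (h.nonneg w) (Ne.symm hne)
    have hcl : IsCompact (Set.Icc a w ∩ f ⁻¹' {0}) :=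
      isCompact_Icc.inter_right (isClosed_singleton.preimage hc)
    obtain ⟨b, ⟨⟨hab, hbw⟩, hb0⟩, hmax⟩ := hcl.exists_isGreatest ⟨a, ⟨le_refl a, hw⟩, ha⟩
    have hb0' : f b = 0 := hb0
    have hbw' : b < w := lt_of_le_of_ne hbw (by rintro rfl; exact hne hb0')
    have hle : ∫ u in b..w, fdot u ≤ ∫ u in b..w, (0 : ℝ) := by
      refine intervalIntegral.integral_mono_on_of_le_Ioo hbw (h.intervalIntegrable b w)
        (by simp) ?_
      intro u hu
      have hu0 : 0 < f u := by
        refine lt_of_le_of_ne (h.nonneg u) fun hu' => ?_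
        exact absurd (hmax ⟨⟨hab.trans hu.1.le, hu.2.le⟩, hu'.symm⟩) (not_le.2 hu.1)
      have := hs u (hab.trans hu.1.le)
      unfold score at this
      rw [le_div_iff₀ hu0] at this
      linarith
    have := h.sub_eq_integral b w hbw'
    simp at hle
    linarith
  -- hence a zero of `f` at some point of the half-line `[0, ∞)` is impossible
  have key : ∀ a, 0 ≤ a → f a = 0 → False := by
    intro a ha0 ha
    have sa : score f fdot a = 0 := by simp [score, ha]
    have sna : score f fdot (-a) = 0 := by simp [score, h.symm, ha]
    have hz := step (-a) (by rw [h.symm, ha]) fun z hz => by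
      rw [← sna]; exact h.monotone_score hz
    have hall : ∀ w, f w = 0 := by
      intro w
      rcases le_total 0 w with hw | hw
      · exact hz w (by linarith)
      · rw [← h.symm]; exact hz (-w) (by linarith)
    have := h.integral_eq_one
    simp [hall] at this
  refine lt_of_le_of_ne (h.nonneg z) fun hz => ?_
  rcases le_total 0 z with h0 | h0
  · exact key z h0 hz.symm
  · exact key (-z) (by linarith) (by rw [h.symm]; exact hz.symm)

theorem integrable_score_sq {φ g : ℝ → ℝ} (hφ : Monotone φ) (hg : Integrable g)
    (hg0 : ∀ z, 0 ≤ g z) (hK : Integrable (fun z => z ^ 4 * φ z ^ 2 * g z)) :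
    Integrable (fun z => φ z ^ 2 * g z) ∧ Integrable (fun z => z ^ 2 * φ z ^ 2 * g z) := by
  have hm := hφ.measurable
  have hdom := (hg.const_mul (φ (-1) ^ 2 + φ 1 ^ 2)).add hK
  have hb : ∀ z, z ^ 2 < 1 → φ z ^ 2 ≤ φ (-1) ^ 2 + φ 1 ^ 2 := by
    intro z hz
    have h1 : φ (-1) ≤ φ z := hφ (by nlinarith)
    have h2 : φ z ≤ φ 1 := hφ (by nlinarith)
    rcases le_total 0 (φ z) with h | h <;> nlinarith [sq_nonneg (φ (-1)), sq_nonneg (φ 1)]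
  refine ⟨hdom.mono' ((hm.pow_const 2).aestronglyMeasurable.mul hg.1) (ae_of_all _ fun z => ?_),
    hdom.mono' ((((measurable_id.pow_const 2).mul
      (hm.pow_const 2))).aestronglyMeasurable.mul hg.1) (ae_of_all _ fun z => ?_)⟩
  · rw [Real.norm_of_nonneg (mul_nonneg (sq_nonneg _) (hg0 z))]
    simp only [Pi.add_apply]
    rw [← add_mul]
    refine mul_le_mul_of_nonneg_right ?_ (hg0 z)
    rcases lt_or_ge (z ^ 2) 1 with h | h
    · nlinarith [hb z h, mul_nonneg (sq_nonneg (z ^ 2)) (sq_nonneg (φ z))]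
    · nlinarith [sq_nonneg (φ (-1)), sq_nonneg (φ 1), sq_nonneg (φ z),
        mul_nonneg (sq_nonneg (φ z)) (by nlinarith : (0 : ℝ) ≤ z ^ 4 - 1)]
  · change ‖z ^ 2 * φ z ^ 2 * g z‖ ≤ _
    rw [Real.norm_of_nonneg (by have := hg0 z; positivity)]
    simp only [Pi.add_apply]
    rw [← add_mul]
    refine mul_le_mul_of_nonneg_right ?_ (hg0 z)
    rcases lt_or_ge (z ^ 2) 1 with h | h
    · nlinarith [hb z h, mul_nonneg (sq_nonneg (z ^ 2)) (sq_nonneg (φ z)),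
        mul_nonneg (sub_nonneg.2 h.le) (sq_nonneg (φ z))]
    · nlinarith [sq_nonneg (φ (-1)), sq_nonneg (φ 1), sq_nonneg (φ z),
        mul_nonneg (sq_nonneg (φ z)) (by nlinarith : (0 : ℝ) ≤ z ^ 4 - z ^ 2)]

theorem MemF1.integrable_infoIJ {f fdot : ℝ → ℝ} (h : MemF1 f fdot) :
    Integrable (fun z => score f fdot z ^ 2 * f z) ∧
      Integrable (fun z => z ^ 2 * score f fdot z ^ 2 * f z) :=
  integrable_score_sq h.monotone_score h.integrable h.nonneg h.integrable_infoK

theorem MemF1.infoI_pos {f fdot : ℝ → ℝ} (h : MemF1 f fdot) : 0 < infoI f fdot := by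
  refine lt_of_le_of_ne (integral_nonneg fun z => mul_nonneg (sq_nonneg _) (h.nonneg z)) ?_
  intro h0
  have hz := (integral_eq_zero_iff_of_nonneg
    (fun z => mul_nonneg (sq_nonneg (score f fdot z)) (h.nonneg z)) h.integrable_infoIJ.1).1 h0.symm
  have hd : ∀ᵐ z, fdot z = 0 := by
    filter_upwards [hz] with z hz
    have hp := (h.pos z).ne'
    simpa [score, hp] using hz
  have hconst : ∀ z, f z = f 0 := by
    have e : ∀ a b, a < b → f b = f a := fun a b hab => by
      have h1 := h.sub_eq_integral a b hab
      have h2 : ∫ u in a..b, fdot u = ∫ u in a..b, (0 : ℝ) :=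
        intervalIntegral.integral_congr_ae (hd.mono fun z hz _ => hz)
      simp at h2
      linarith
    intro z
    rcases lt_trichotomy 0 z with hz | hz | hz
    · exact e 0 z hz
    · rw [hz]
    · exact (e z 0 hz).symm
  have := h.integral_eq_one
  simp [hconst, Measure.real] at this

theorem MemFCross.integrable_cross {f fdot g gdot : ℝ → ℝ} (hf : MemF1 f fdot)
    (h : MemFCross f fdot g gdot) :
    Integrable (fun z => score f fdot z * score g gdot z * g z) ∧
      Integrable (fun z => z ^ 2 * score f fdot z * score g gdot z * g z) := by
  have hI := (integrable_score_sq hf.monotone_score h.memF1.integrable h.memF1.nonneg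
    h.integrable_infoK).1
  have hG := h.memF1.integrable_infoIJ.1
  have mf := hf.monotone_score.measurable
  have mg := h.memF1.monotone_score.measurable
  refine ⟨(hI.add hG).mono' ((mf.mul mg).aestronglyMeasurable.mul h.memF1.integrable.1)
      (ae_of_all _ fun z => ?_),
    (h.integrable_infoK.add hG).mono' ((((measurable_id.pow_const 2).mul mf).mul
      mg).aestronglyMeasurable.mul h.memF1.integrable.1) (ae_of_all _ fun z => ?_)⟩
  · rw [norm_mul, Real.norm_of_nonneg (h.memF1.nonneg z), Real.norm_eq_abs]
    simp only [Pi.add_apply]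
    rw [← add_mul]
    refine mul_le_mul_of_nonneg_right (abs_le.2 ⟨?_, ?_⟩) (h.memF1.nonneg z) <;>
    nlinarith [sq_nonneg (score f fdot z + score g gdot z),
      sq_nonneg (score f fdot z - score g gdot z)]
  · change ‖z ^ 2 * score f fdot z * score g gdot z * g z‖ ≤ _
    rw [norm_mul, Real.norm_of_nonneg (h.memF1.nonneg z), Real.norm_eq_abs]
    simp only [Pi.add_apply]
    rw [← add_mul]
    refine mul_le_mul_of_nonneg_right (abs_le.2 ⟨?_, ?_⟩) (h.memF1.nonneg z) <;>
    nlinarith [sq_nonneg (z ^ 2 * score f fdot z + score g gdot z),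
      sq_nonneg (z ^ 2 * score f fdot z - score g gdot z)]

end SymmetryTest

/-! Write `h` for the function `skewScore`. If the new standardized observations are `r Z + d`, the
change in `Delta3` is `n^{-1/2} ∑ (h (r Zᵢ + d) - h (Zᵢ))`, a normalized row sum of an i.i.d. array.
By Chebyshev (`isLittleOP_pi_sum`) it suffices that the second moment of one increment tends to zero
and that `√n` times its mean converges.

The second moment is handled by `L²(g)`-continuity, since `h` is a.e. continuous. For the mean, `h`
is never differentiated: a location shift is moved onto `g`, and the limit is an integral of `h`
against `gdot`, which is the cross-information term. For a scale change the mean is exactly zero,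
because `h` is a.e. odd and `g` is even.

Every domination comes from two facts: the score grows at most polynomially (tail condition,
monotonicity and symmetry), and a density with monotone score decays exponentially (`MemF1.le_exp`).
-/

namespace SymmetryTest

/-! ### Subexponential growth. -/

/-- A function dominated by `exp (ε |z|)` for every `ε > 0`. -/
def SubexpGrowth (φ : ℝ → ℝ) : Prop :=
  ∀ ε : ℝ, 0 < ε → ∃ C, 0 ≤ C ∧ ∀ z, |φ z| ≤ C * Real.exp (ε * |z|)

theorem SubexpGrowth.mul {φ ψ : ℝ → ℝ} (hφ : SubexpGrowth φ) (hψ : SubexpGrowth ψ) :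
    SubexpGrowth fun z => φ z * ψ z := by
  intro ε hε
  obtain ⟨C, hC, h1⟩ := hφ (ε / 2) (by positivity)
  obtain ⟨D, hD, h2⟩ := hψ (ε / 2) (by positivity)
  refine ⟨C * D, by positivity, fun z => ?_⟩
  rw [abs_mul]
  calc |φ z| * |ψ z| ≤ (C * Real.exp (ε / 2 * |z|)) * (D * Real.exp (ε / 2 * |z|)) :=
        mul_le_mul (h1 z) (h2 z) (abs_nonneg _) (by positivity)
    _ = C * D * (Real.exp (ε / 2 * |z|) * Real.exp (ε / 2 * |z|)) := by ring
    _ = C * D * Real.exp (ε * |z|) := by rw [← Real.exp_add]; congr 2; ring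

theorem SubexpGrowth.of_le_pow {φ : ℝ → ℝ} {C : ℝ} (hC : 0 ≤ C) (m : ℕ)
    (h : ∀ z, |φ z| ≤ C * (1 + |z|) ^ m) : SubexpGrowth φ := by
  intro ε hε
  refine ⟨C * ((m.factorial : ℝ) / ε ^ m * Real.exp ε), by positivity, fun z => (h z).trans ?_⟩
  have h1 := Real.pow_div_factorial_le_exp (x := ε * (1 + |z|)) (by positivity) m
  rw [div_le_iff₀ (by positivity), mul_pow, mul_add, mul_one, Real.exp_add] at h1
  rw [mul_assoc]
  refine mul_le_mul_of_nonneg_left ?_ hC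
  rw [div_mul_eq_mul_div, div_mul_eq_mul_div, le_div_iff₀ (by positivity)]
  linarith

theorem integrable_exp_neg_mul_abs {c : ℝ} (hc : 0 < c) :
    Integrable fun z : ℝ => Real.exp (-c * |z|) := by
  rw [← integrableOn_univ, ← Set.Iic_union_Ioi (a := (0 : ℝ))]
  refine IntegrableOn.union ?_ ?_
  · refine (integrableOn_exp_mul_Iic hc 0).congr_fun (fun z hz => ?_) measurableSet_Iic
    simp only [abs_of_nonpos (Set.mem_Iic.1 hz)]
    ring_nf
  · refine (integrableOn_exp_mul_Ioi (neg_lt_zero.2 hc) 0).congr_fun (fun z hz => ?_)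
      measurableSet_Ioi
    simp only [abs_of_pos (Set.mem_Ioi.1 hz)]

variable {f fdot g gdot : ℝ → ℝ}

/-! ### Regularity, oddness and growth of the score. -/

theorem MemF1.fdot_eq (h : MemF1 f fdot) (z : ℝ) : fdot z = -(score f fdot z * f z) := by
  have := (h.pos z).ne'
  simp only [score]
  field_simp

theorem MemF1.sub_eq_intervalIntegral (h : MemF1 f fdot) (x y : ℝ) :
    f y - f x = ∫ u in x..y, fdot u := by
  rcases lt_trichotomy x y with hxy | rfl | hxy
  · exact h.sub_eq_integral x y hxy
  · simp
  · rw [intervalIntegral.integral_symm, ← h.sub_eq_integral y x hxy, neg_sub]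

theorem MemF1.measurable_fdot (h : MemF1 f fdot) : Measurable fdot := by
  rw [show fdot = fun z => -(score f fdot z * f z) from funext h.fdot_eq]
  exact (h.monotone_score.measurable.mul h.continuous.measurable).neg

/-- Since `fdot = -score * f` with `f` continuous, continuity points of the score are continuity
points of `fdot`, and the fundamental theorem of calculus applies there. -/
theorem MemF1.hasDerivAt (h : MemF1 f fdot) {z : ℝ} (hz : ContinuousAt (score f fdot) z) :
    HasDerivAt f (fdot z) z := by
  have hc : ContinuousAt fdot z := by
    rw [show fdot = fun z => -(score f fdot z * f z) from funext h.fdot_eq]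
    exact (hz.mul h.continuous.continuousAt).neg
  have e : f = fun z => f 0 + ∫ u in (0 : ℝ)..z, fdot u := by
    funext z
    linarith [h.sub_eq_intervalIntegral 0 z]
  rw [e]
  exact (intervalIntegral.integral_hasDerivAt_right (h.intervalIntegrable 0 z)
    (h.measurable_fdot.stronglyMeasurable.stronglyMeasurableAtFilter) hc).const_add _

theorem MemF1.ae_continuousAt (h : MemF1 f fdot) : ∀ᵐ z, ContinuousAt (score f fdot) z := by
  have := h.monotone_score.countable_not_continuousAt.ae_notMem volume
  filter_upwards [this] with z hz
  simpa using hz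

/-- Differentiate `f (-z) = f z` where the score is continuous at both `z` and `-z`. At a jump the
value of the score is constrained only by monotonicity, so oddness can fail there. -/
theorem MemF1.ae_score_neg (h : MemF1 f fdot) :
    ∀ᵐ z, score f fdot (-z) = -score f fdot z := by
  have h2 : ∀ᵐ z : ℝ, ContinuousAt (score f fdot) (-z) :=
    (Measure.measurePreserving_neg (volume : Measure ℝ)).quasiMeasurePreserving.ae h.ae_continuousAt
  filter_upwards [h.ae_continuousAt, h2] with z h1 h2
  have d1 := h.hasDerivAt h1
  have d2 := (h.hasDerivAt h2).comp z (hasDerivAt_neg z)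
  have e : f ∘ Neg.neg = f := funext h.symm
  rw [e] at d2
  have := d1.unique d2
  simp only [score, h.symm, this]
  ring

theorem MemF1.subexpGrowth_score (h : MemF1 f fdot) : SubexpGrowth (score f fdot) := by
  obtain ⟨β, -, -, ho⟩ := h.tails
  have hev := (ho.bound one_pos).and (eventually_ge_atTop 1)
  obtain ⟨A, hA⟩ := eventually_atTop.1 hev
  set B := max A 1
  have hB : 1 ≤ B := le_max_right _ _
  -- Any integer exponent at least `β / 2 - 2` would do.
  set m := ⌈|β|⌉₊
  have hup : ∀ z, B ≤ z → |score f fdot z| ≤ z ^ m := by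
    intro z hz
    obtain ⟨h1, h2⟩ := hA z ((le_max_left _ _).trans hz)
    rw [one_mul, Real.norm_eq_abs, Real.norm_of_nonneg (by positivity)] at h1
    refine h1.trans ?_
    rw [← Real.rpow_natCast]
    refine Real.rpow_le_rpow_of_exponent_le h2 ?_
    have := Nat.le_ceil |β|
    have := le_abs_self β
    have := abs_nonneg β
    linarith
  refine SubexpGrowth.of_le_pow (C := (B + 1) ^ m) (by positivity) m fun z => ?_
  have hpos : ∀ w, |z| ≤ w → w ≤ |z| + 1 → score f fdot w ≤ (B + 1) ^ m * (1 + |z|) ^ m := by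
    intro w _ h2
    have hw : B ≤ max w B := le_max_right _ _
    calc score f fdot w ≤ score f fdot (max w B) := h.monotone_score (le_max_left _ _)
      _ ≤ (max w B) ^ m := (le_abs_self _).trans (hup _ hw)
      _ ≤ ((B + 1) * (1 + |z|)) ^ m := by
          refine pow_le_pow_left₀ (by linarith) (max_le ?_ ?_) m <;> nlinarith [abs_nonneg z]
      _ = _ := mul_pow _ _ _
  refine abs_le.2 ⟨?_, (h.monotone_score (le_abs_self z)).trans (hpos _ le_rfl (by linarith))⟩
  -- The tail condition concerns `+∞` only. Oddness carries it to `-∞`, but holds only a.e., so a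
  -- good point `w` is taken slightly beyond `|z|`; monotonicity absorbs the gap.
  obtain ⟨w, hw, h1⟩ : ∃ w, score f fdot (-w) = -score f fdot w ∧ w ∈ Set.Ioo |z| (|z| + 1) := by
    by_contra hcon
    push Not at hcon
    have h0 : volume (Set.Ioo |z| (|z| + 1)) = 0 :=
      measure_mono_null (fun w hw hw' => hcon w hw' hw) h.ae_score_neg
    simp at h0
  have h2 : score f fdot (-w) ≤ score f fdot z :=
    h.monotone_score (by linarith [neg_abs_le z, h1.1])
  have := hpos w h1.1.le h1.2.le
  linarith

/-! ### Exponential decay of the density. -/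

theorem MemF1.exists_score_pos (h : MemF1 f fdot) : ∃ w, 0 < w ∧ 0 < score f fdot w := by
  by_contra hcon
  push Not at hcon
  -- A nonpositive score would make `f` nondecreasing on the half-line, hence not integrable.
  have hge : ∀ z, 0 < z → f 0 ≤ f z := by
    intro z hz
    have h1 := h.sub_eq_integral 0 z hz
    have h2 : 0 ≤ ∫ u in (0 : ℝ)..z, fdot u := by
      rw [intervalIntegral.integral_of_le hz.le]
      refine setIntegral_nonneg measurableSet_Ioc fun u hu => ?_
      rw [h.fdot_eq]
      nlinarith [hcon u hu.1, h.nonneg u]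
    linarith
  have hi : IntegrableOn (fun _ : ℝ => f 0) (Set.Ioi 0) := by
    refine (h.integrable.integrableOn (s := Set.Ioi 0)).mono' aestronglyMeasurable_const ?_
    refine (ae_restrict_iff' measurableSet_Ioi).2 (ae_of_all _ fun z hz => ?_)
    rw [Real.norm_of_nonneg (h.nonneg 0)]
    exact hge z hz
  rw [integrableOn_const_iff] at hi
  simp [(h.pos 0).ne'] at hi

/-- Beyond a point `w` where the score equals `c > 0`, the score is at least `c`, so `exp (c z) f z`
is nonincreasing; symmetry gives the other side. -/
theorem MemF1.le_exp (h : MemF1 f fdot) :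
    ∃ C c, 0 ≤ C ∧ 0 < c ∧ ∀ z, f z ≤ C * Real.exp (-c * |z|) := by
  obtain ⟨w, hw, hc⟩ := h.exists_score_pos
  set c := score f fdot w with hcdef
  obtain ⟨M, hM⟩ := (isCompact_Icc (a := (0 : ℝ)) (b := w)).bddAbove_image h.continuous.continuousOn
  have hM' : ∀ z, 0 ≤ z → z ≤ w → f z ≤ M := fun z h0 h1 => hM ⟨z, ⟨h0, h1⟩, rfl⟩
  have hM0 : 0 ≤ M := (h.nonneg 0).trans (hM' 0 le_rfl hw.le)
  have hdecay : ∀ z, w ≤ z → Real.exp (c * z) * f z ≤ Real.exp (c * w) * f w := by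
    intro z hz
    have hcont : Continuous fun u => Real.exp (c * u) * f u :=
      (by fun_prop : Continuous fun u => Real.exp (c * u)).mul h.continuous
    have hi : IntervalIntegrable
        (fun u => (c - score f fdot u) * (Real.exp (c * u) * f u)) volume w z :=
      (intervalIntegrable_const.sub h.monotone_score.intervalIntegrable).mul_continuousOn
        hcont.continuousOn
    -- The derivative is available only off the countable set of jumps of the score.
    have key := integral_eq_of_hasDerivAt_off_countable (fun u => Real.exp (c * u) * f u) _
      h.monotone_score.countable_not_continuousAt hcont.continuousOn
      (fun x hx => by
        have h1 := h.hasDerivAt (not_not.1 hx.2)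
        have h2 : HasDerivAt (fun u => Real.exp (c * u)) (Real.exp (c * x) * c) x := by
          simpa using ((hasDerivAt_id x).const_mul c).exp
        convert! h2.mul h1 using 1
        rw [h.fdot_eq x]
        ring) hi
    have hneg : ∫ u in w..z, (c - score f fdot u) * (Real.exp (c * u) * f u) ≤ 0 := by
      rw [intervalIntegral.integral_of_le hz]
      refine setIntegral_nonpos measurableSet_Ioc fun u hu => ?_
      refine mul_nonpos_of_nonpos_of_nonneg ?_ (mul_nonneg (Real.exp_pos _).le (h.nonneg u))
      exact sub_nonpos.2 (h.monotone_score hu.1.le)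
    linarith
  refine ⟨M * Real.exp (c * w), c, by positivity, hc, fun z => ?_⟩
  have e : f z = f |z| := by
    rcases abs_choice z with h' | h' <;> rw [h']
    rw [h.symm]
  rw [e, mul_assoc, ← Real.exp_add]
  rcases le_total |z| w with h1 | h1
  · refine (hM' _ (abs_nonneg z) h1).trans ?_
    refine le_mul_of_one_le_right hM0 (Real.one_le_exp ?_)
    nlinarith
  · have h2 := hdecay _ h1
    have h3 := hM' w hw.le le_rfl
    rw [← mul_le_mul_iff_right₀ (Real.exp_pos (c * |z|))]
    calc _ ≤ _ := h2
      _ ≤ Real.exp (c * w) * M := by gcongr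
      _ = M * (Real.exp (c * |z|) * Real.exp (c * w + -c * |z|)) := by
        rw [← Real.exp_add]; ring_nf
      _ = _ := by ring

/-! ### Weak law for triangular arrays. -/

/-- A weak law for row sums of i.i.d. arrays, by Chebyshev's inequality. -/
theorem isLittleOP_pi_sum (μ : Measure ℝ) [IsProbabilityMeasure μ] {K : ℕ → ℝ → ℝ} {m : ℝ}
    (hL : ∀ n, MemLp (K n) 2 μ)
    (h2 : Tendsto (fun n => ∫ x, K n x ^ 2 ∂μ) atTop (𝓝 0))
    (h1 : Tendsto (fun n : ℕ => √(n : ℝ) * ∫ x, K n x ∂μ) atTop (𝓝 m)) :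
    IsLittleOP (fun n => Measure.pi fun _ : Fin n => μ)
      (fun n x => (√(n : ℝ))⁻¹ * ∑ i, K n (x i) - m) := by
  intro ε hε
  -- Half of `ε` pays for the deviation from the mean, the other half for the distance from the mean
  -- to `m`.
  have hlim : Tendsto (fun n => ENNReal.ofReal ((∫ x, K n x ^ 2 ∂μ) / (ε / 2) ^ 2)) atTop (𝓝 0) := by
    have := ENNReal.tendsto_ofReal (h2.div_const ((ε / 2) ^ 2))
    simpa using this
  refine tendsto_of_tendsto_of_tendsto_of_le_of_le' tendsto_const_nhds hlim
    (Eventually.of_forall fun _ => zero_le) ?_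
  filter_upwards [Metric.tendsto_nhds.1 h1 (ε / 2) (by positivity), eventually_ge_atTop 1]
    with n hn hn1
  have hnpos : (0 : ℝ) < n := by exact_mod_cast hn1
  have hcomp : ∀ i : Fin n, MemLp (fun x : Fin n → ℝ => K n (x i)) 2
      (Measure.pi fun _ : Fin n => μ) := fun i =>
    (hL n).comp_measurePreserving (measurePreserving_eval (fun _ : Fin n => μ) i)
  have hX : MemLp (fun x : Fin n → ℝ => (√(n : ℝ))⁻¹ * ∑ i, K n (x i)) 2
      (Measure.pi fun _ : Fin n => μ) := (memLp_finsetSum _ fun i _ => hcomp i).const_mul _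
  have hmean : ∫ x, (√(n : ℝ))⁻¹ * ∑ i, K n (x i) ∂(Measure.pi fun _ : Fin n => μ)
      = √(n : ℝ) * ∫ x, K n x ∂μ := by
    rw [integral_const_mul, integral_finsetSum _ fun i _ => (hcomp i).integrable one_le_two]
    simp_rw [integral_comp_eval (μ := fun _ : Fin n => μ) (hL n).aestronglyMeasurable]
    rw [Finset.sum_const, Finset.card_univ, Fintype.card_fin, nsmul_eq_mul, ← mul_assoc]
    congr 1
    rw [inv_mul_eq_div, Real.div_sqrt]
  have hvar : ProbabilityTheory.variance (fun x : Fin n → ℝ => (√(n : ℝ))⁻¹ * ∑ i, K n (x i))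
      (Measure.pi fun _ : Fin n => μ) ≤ ∫ x, K n x ^ 2 ∂μ := by
    have hs := ProbabilityTheory.variance_sum_pi (μ := fun _ : Fin n => μ)
      (X := fun _ : Fin n => K n) fun _ => hL n
    rw [Finset.sum_fn] at hs
    rw [ProbabilityTheory.variance_const_mul, hs, Finset.sum_const, Finset.card_univ,
      Fintype.card_fin, nsmul_eq_mul, ← mul_assoc, inv_pow, Real.sq_sqrt hnpos.le,
      inv_mul_cancel₀ hnpos.ne', one_mul]
    exact ProbabilityTheory.variance_le_expectation_sq (hL n).aestronglyMeasurable
  refine (measure_mono fun x hx => ?_).trans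
    ((ProbabilityTheory.meas_ge_le_variance_div_sq hX (c := ε / 2) (by positivity)).trans
      (ENNReal.ofReal_le_ofReal (by gcongr)))
  simp only [Set.mem_ofPred_eq] at hx ⊢
  rw [hmean]
  rw [Real.dist_eq] at hn
  have := abs_sub_le ((√(n : ℝ))⁻¹ * ∑ i, K n (x i)) (√(n : ℝ) * ∫ x, K n x ∂μ) m
  linarith

/-! ### Reduction of the sampling law to integrals against `g`. -/

theorem MemF1.measurable_density (h : MemF1 g gdot) (θ σ : ℝ) :
    Measurable fun x => ENNReal.ofReal (σ⁻¹ * g ((x - θ) / σ)) := by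
  have := h.continuous.measurable
  fun_prop

theorem MemF1.toReal_density (h : MemF1 g gdot) {θ σ : ℝ} (hσ : 0 < σ) (x : ℝ) :
    (ENNReal.ofReal (σ⁻¹ * g ((x - θ) / σ))).toReal = σ⁻¹ * g ((x - θ) / σ) :=
  ENNReal.toReal_ofReal (mul_nonneg (inv_nonneg.2 hσ.le) (h.nonneg _))

theorem integral_stdObs (F : ℝ → ℝ) {θ σ : ℝ} (hσ : 0 < σ) :
    ∫ x, σ⁻¹ * F ((x - θ) / σ) = ∫ z, F z := by
  rw [integral_const_mul, integral_sub_right_eq_self (fun x => F (x / σ)) θ,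
    Measure.integral_comp_div, abs_of_pos hσ, smul_eq_mul, inv_mul_cancel_left₀ hσ.ne']

theorem integrable_stdObs {F : ℝ → ℝ} (hF : Integrable F) {θ σ : ℝ} (hσ : 0 < σ) :
    Integrable fun x => σ⁻¹ * F ((x - θ) / σ) :=
  ((hF.comp_div hσ.ne').comp_sub_right θ).const_mul _

theorem MemF1.isProbabilityMeasure (h : MemF1 g gdot) {θ σ : ℝ} (hσ : 0 < σ) :
    IsProbabilityMeasure ((volume : Measure ℝ).withDensity
      fun x => ENNReal.ofReal (σ⁻¹ * g ((x - θ) / σ))) := by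
  refine ⟨?_⟩
  rw [withDensity_apply _ MeasurableSet.univ, Measure.restrict_univ,
    ← ofReal_integral_eq_lintegral_ofReal (integrable_stdObs h.integrable hσ)
    (ae_of_all _ fun x => mul_nonneg (inv_nonneg.2 hσ.le) (h.nonneg _)), integral_stdObs g hσ,
    h.integral_eq_one, ENNReal.ofReal_one]

theorem MemF1.integral_law (h : MemF1 g gdot) {θ σ : ℝ} (hσ : 0 < σ) (F : ℝ → ℝ) :
    ∫ x, F (stdObs θ σ x) ∂((volume : Measure ℝ).withDensity
      fun x => ENNReal.ofReal (σ⁻¹ * g ((x - θ) / σ))) = ∫ z, F z * g z := by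
  rw [integral_withDensity_eq_integral_toReal_smul (h.measurable_density θ σ) (by simp),
    ← integral_stdObs (fun z => F z * g z) hσ (θ := θ)]
  refine integral_congr_ae (ae_of_all _ fun x => ?_)
  simp only [h.toReal_density hσ, stdObs, smul_eq_mul, inv_mul_eq_div σ (x - θ)]
  ring

theorem MemF1.integrable_law (h : MemF1 g gdot) {θ σ : ℝ} (hσ : 0 < σ) {F : ℝ → ℝ}
    (hF : Integrable fun z => F z * g z) :
    Integrable (fun x => F (stdObs θ σ x)) ((volume : Measure ℝ).withDensity
      fun x => ENNReal.ofReal (σ⁻¹ * g ((x - θ) / σ))) := by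
  rw [integrable_withDensity_iff (h.measurable_density θ σ) (by simp)]
  refine (integrable_stdObs hF hσ (θ := θ)).congr (ae_of_all _ fun x => ?_)
  simp only [h.toReal_density hσ, stdObs, inv_mul_eq_div σ (x - θ)]
  ring

theorem MemF1.isLittleOP_nullLaw (h : MemF1 g gdot) {θ σ : ℝ} (hσ : 0 < σ) {K : ℕ → ℝ → ℝ}
    {m : ℝ} (hK : ∀ n, Measurable (K n)) (hL : ∀ n, Integrable fun z => K n z ^ 2 * g z)
    (h2 : Tendsto (fun n => ∫ z, K n z ^ 2 * g z) atTop (𝓝 0))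
    (h1 : Tendsto (fun n : ℕ => √(n : ℝ) * ∫ z, K n z * g z) atTop (𝓝 m)) :
    IsLittleOP (fun n => nullLaw n θ σ g)
      (fun n x => (√(n : ℝ))⁻¹ * ∑ i, K n (stdObs θ σ (x i)) - m) := by
  have := h.isProbabilityMeasure hσ (θ := θ)
  have hm : Measurable (stdObs θ σ) := by unfold stdObs; fun_prop
  have key := isLittleOP_pi_sum _ (K := fun n x => K n (stdObs θ σ x))
    (fun n => (memLp_two_iff_integrable_sq ((hK n).comp hm).aestronglyMeasurable).2
      (h.integrable_law hσ (F := fun z => K n z ^ 2) (hL n)))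
    (h2.congr fun n => (h.integral_law hσ (θ := θ) fun z => K n z ^ 2).symm)
    (h1.congr fun n => congrArg _ (h.integral_law hσ (θ := θ) (K n)).symm)
  exact key

/-! ### Affine changes of variable under the integral. -/

theorem SubexpGrowth.abs_comp_affine_le {φ : ℝ → ℝ} (hφ : SubexpGrowth φ) (R D : ℝ) (hR : 0 ≤ R)
    {ε : ℝ} (hε : 0 < ε) : ∃ C, 0 ≤ C ∧ ∀ r d z : ℝ, |r| ≤ R → |d| ≤ D →
      |φ (r * z + d)| ≤ C * Real.exp (ε * |z|) := by
  -- `R + 1` rather than `R` keeps the division valid at `R = 0`.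
  obtain ⟨C, hC, h⟩ := hφ (ε / (R + 1)) (by positivity)
  refine ⟨C * Real.exp (ε / (R + 1) * D), by positivity, fun r d z hr hd => (h _).trans ?_⟩
  rw [mul_assoc, ← Real.exp_add]
  have h1 : |r * z + d| ≤ R * |z| + D := (abs_add_le _ _).trans (by rw [abs_mul]; gcongr)
  have h2 : ε / (R + 1) * (R * |z| + D) ≤ ε / (R + 1) * D + ε * |z| := by
    have : ε / (R + 1) * (R * |z|) ≤ ε / (R + 1) * ((R + 1) * |z|) := by gcongr; linarith
    rw [← mul_assoc (ε / (R + 1)) (R + 1), div_mul_cancel₀ _ (by positivity)] at this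
    linarith
  gcongr
  exact (mul_le_mul_of_nonneg_left h1 (by positivity)).trans h2

theorem SubexpGrowth.comp_affine {φ : ℝ → ℝ} (hφ : SubexpGrowth φ) (r d : ℝ) :
    SubexpGrowth fun z => φ (r * z + d) := fun _ hε =>
  let ⟨C, hC, h⟩ := hφ.abs_comp_affine_le |r| |d| (abs_nonneg r) hε
  ⟨C, hC, fun z => h r d z le_rfl le_rfl⟩

theorem SubexpGrowth.sub {φ ψ : ℝ → ℝ} (hφ : SubexpGrowth φ) (hψ : SubexpGrowth ψ) :
    SubexpGrowth fun z => φ z - ψ z := by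
  intro ε hε
  obtain ⟨C, hC, h1⟩ := hφ ε hε
  obtain ⟨D, hD, h2⟩ := hψ ε hε
  refine ⟨C + D, by positivity, fun z => (abs_sub _ _).trans ?_⟩
  rw [add_mul]
  exact add_le_add (h1 z) (h2 z)

theorem MemF1.integrable_mul (h : MemF1 g gdot) {φ : ℝ → ℝ} (hm : Measurable φ)
    (hφ : SubexpGrowth φ) : Integrable fun z => φ z * g z := by
  obtain ⟨C, c, hC, hc, hle⟩ := h.le_exp
  obtain ⟨D, hD, hb⟩ := hφ (c / 2) (by positivity)
  refine ((integrable_exp_neg_mul_abs (c := c / 2) (by positivity)).const_mul (D * C)).mono'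
    (hm.mul h.continuous.measurable).aestronglyMeasurable (ae_of_all _ fun z => ?_)
  rw [norm_mul, Real.norm_of_nonneg (h.nonneg z), Real.norm_eq_abs]
  calc |φ z| * g z ≤ (D * Real.exp (c / 2 * |z|)) * (C * Real.exp (-c * |z|)) :=
        mul_le_mul (hb z) (hle z) (h.nonneg z) (by positivity)
    _ = D * C * (Real.exp (c / 2 * |z|) * Real.exp (-c * |z|)) := by ring
    _ = _ := by rw [← Real.exp_add]; ring_nf

/-- `L²(g)`-continuity of affine changes of variable. -/
theorem MemF1.tendsto_integral_sq_increment (h : MemF1 g gdot) {φ : ℝ → ℝ} (hm : Measurable φ)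
    (hφ : SubexpGrowth φ) (hc : ∀ᵐ z, ContinuousAt φ z) {r d : ℕ → ℝ}
    (hr : Tendsto r atTop (𝓝 1)) (hd : Tendsto d atTop (𝓝 0)) :
    Tendsto (fun n => ∫ z, (φ (r n * z + d n) - φ z) ^ 2 * g z) atTop (𝓝 0) := by
  obtain ⟨C, c, hC, hc0, hle⟩ := h.le_exp
  -- Eventually `|r n| ≤ 2` and `|d n| ≤ 1`. Squaring doubles the rate `c / 4`, so half of the decay
  -- of `g` survives.
  obtain ⟨D, hD, hb⟩ := hφ.abs_comp_affine_le 2 1 zero_le_two (ε := c / 4) (by positivity)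
  have hr' : ∀ᶠ n in atTop, |r n| ≤ 2 := hr.abs.eventually_le_const (by norm_num)
  have hd' : ∀ᶠ n in atTop, |d n| ≤ 1 := hd.abs.eventually_le_const (by norm_num)
  have hgm := h.continuous.measurable
  have key := tendsto_integral_filter_of_dominated_convergence (μ := volume) (l := atTop)
    (F := fun n z => (φ (r n * z + d n) - φ z) ^ 2 * g z) (f := fun _ => (0 : ℝ))
    (fun z => (2 * D) ^ 2 * C * Real.exp (-(c / 2) * |z|))
    (Eventually.of_forall fun n => by fun_prop)
    ?_ ((integrable_exp_neg_mul_abs (by positivity)).const_mul _) ?_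
  · simpa using key
  · filter_upwards [hr', hd'] with n h1 h2
    refine ae_of_all _ fun z => ?_
    rw [Real.norm_of_nonneg (mul_nonneg (sq_nonneg _) (h.nonneg z))]
    have h3 := hb (r n) (d n) z h1 h2
    have h4 := hb 1 0 z (by norm_num) (by norm_num)
    rw [one_mul, add_zero] at h4
    have h5 : |φ (r n * z + d n) - φ z| ≤ 2 * D * Real.exp (c / 4 * |z|) :=
      (abs_sub _ _).trans (by linarith)
    calc (φ (r n * z + d n) - φ z) ^ 2 * g z
        ≤ (2 * D * Real.exp (c / 4 * |z|)) ^ 2 * (C * Real.exp (-c * |z|)) := by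
          rw [← sq_abs]
          exact mul_le_mul (pow_le_pow_left₀ (abs_nonneg _) h5 2) (hle z) (h.nonneg z)
            (by positivity)
      _ = (2 * D) ^ 2 * C *
          (Real.exp (c / 4 * |z|) * Real.exp (c / 4 * |z|) * Real.exp (-c * |z|)) := by ring
      _ = _ := by rw [← Real.exp_add, ← Real.exp_add]; ring_nf
  · filter_upwards [hc] with z hz
    have h1 : Tendsto (fun n => r n * z + d n) atTop (𝓝 z) := by
      simpa using (hr.mul_const z).add hd
    have h2 := (((hz.tendsto.comp h1).sub_const (φ z)).pow 2).mul_const (g z)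
    simpa using h2

theorem tendsto_inv_sqrt_natCast : Tendsto (fun n : ℕ => (√(n : ℝ))⁻¹) atTop (𝓝 0) :=
  tendsto_inv_atTop_zero.comp (Real.tendsto_sqrt_atTop.comp tendsto_natCast_atTop_atTop)

/-- Differentiation of `∫ φ(z) g(z + u) dz` in the shift `u`. -/
theorem MemF1.tendsto_sqrt_mul_integral_shift (h : MemF1 g gdot) {φ : ℝ → ℝ} (hm : Measurable φ)
    (hφ : SubexpGrowth φ) (a : ℝ) :
    Tendsto (fun n : ℕ => √(n : ℝ) * ∫ z, (φ (1 * z + -((√(n : ℝ))⁻¹ * a)) - φ z) * g z) atTop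
      (𝓝 (∫ z, φ z * (a * gdot z))) := by
  obtain ⟨C, c, hC, hc0, hle⟩ := h.le_exp
  obtain ⟨D, hD, hb⟩ := hφ (c / 4) (by positivity)
  obtain ⟨E, hE, hs⟩ := h.subexpGrowth_score.abs_comp_affine_le 1 1 zero_le_one
    (ε := c / 4) (by positivity)
  have hgm := h.continuous.measurable
  have hδ : Tendsto (fun n : ℕ => (√(n : ℝ))⁻¹ * a) atTop (𝓝 0) := by
    simpa using tendsto_inv_sqrt_natCast.mul_const a
  have hδ' : ∀ᶠ n : ℕ in atTop, |(√(n : ℝ))⁻¹ * a| ≤ 1 :=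
    hδ.abs.eventually_le_const (by norm_num)
  -- Translation invariance moves the shift from `φ`, which may have jumps, to `g`.
  have hshift : ∀ n : ℕ, √(n : ℝ) * ∫ z, (φ (1 * z + -((√(n : ℝ))⁻¹ * a)) - φ z) * g z
      = ∫ z, φ z * (√(n : ℝ) * (g (z + (√(n : ℝ))⁻¹ * a) - g z)) := by
    intro n
    set δ := (√(n : ℝ))⁻¹ * a
    have i1 : Integrable fun z => φ (1 * z + -δ) * g z :=
      h.integrable_mul (by fun_prop) (hφ.comp_affine 1 (-δ))
    have i2 := h.integrable_mul hm hφ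
    have i3 : Integrable fun z => φ z * g (z + δ) := by
      simpa using i1.comp_add_right δ
    have e : ∫ z, φ (1 * z + -δ) * g z = ∫ z, φ z * g (z + δ) := by
      rw [← integral_add_right_eq_self _ δ]
      simp
    simp_rw [sub_mul]
    rw [integral_sub i1 i2, e, ← integral_sub i3 i2, ← integral_const_mul]
    congr with z
    ring
  simp_rw [hshift]
  refine tendsto_integral_filter_of_dominated_convergence
    (fun z => D * E * C * |a| * Real.exp c * Real.exp (-(c / 2) * |z|))
    (Eventually.of_forall fun n => by fun_prop) ?_
    ((integrable_exp_neg_mul_abs (by positivity)).const_mul _) ?_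
  · filter_upwards [hδ', eventually_ge_atTop 1] with n hn hn1
    refine ae_of_all _ fun z => ?_
    have hspos : 0 < √(n : ℝ) := Real.sqrt_pos.2 (by exact_mod_cast hn1)
    -- Bounding `gdot` between `z` and the shifted point dominates the difference quotient; `exp c`
    -- pays for replacing `|u|` by `|z|`, as `|u - z| ≤ 1`.
    have hB : ∀ u ∈ Set.uIoc z (z + (√(n : ℝ))⁻¹ * a),
        ‖gdot u‖ ≤ E * Real.exp (c / 4 * |z|) * (C * (Real.exp c * Real.exp (-c * |z|))) := by
      intro u hu
      have hu1 : |u - z| ≤ 1 := by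
        have := Set.abs_sub_left_of_mem_uIcc (Set.uIoc_subset_uIcc hu)
        rw [add_sub_cancel_left] at this
        exact this.trans hn
      rw [h.fdot_eq, norm_neg, norm_mul, Real.norm_of_nonneg (h.nonneg u), Real.norm_eq_abs]
      have h1 := hs 1 (u - z) z (by norm_num) hu1
      rw [one_mul, add_sub_cancel] at h1
      refine mul_le_mul h1 ((hle u).trans ?_) (h.nonneg u) (by positivity)
      rw [← Real.exp_add]
      gcongr
      have h2 : |z| ≤ |u| + 1 := by
        have := abs_sub_abs_le_abs_sub z u
        rw [abs_sub_comm] at this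
        linarith
      nlinarith
    have hI := intervalIntegral.norm_integral_le_of_norm_le_const hB
    rw [← h.sub_eq_intervalIntegral, add_sub_cancel_left, abs_mul, abs_inv, abs_of_pos hspos,
      Real.norm_eq_abs] at hI
    rw [norm_mul, norm_mul, Real.norm_of_nonneg hspos.le, Real.norm_eq_abs, Real.norm_eq_abs]
    calc |φ z| * (√(n : ℝ) * |g (z + (√(n : ℝ))⁻¹ * a) - g z|)
        ≤ (D * Real.exp (c / 4 * |z|)) * (√(n : ℝ) * (E * Real.exp (c / 4 * |z|) *
            (C * (Real.exp c * Real.exp (-c * |z|))) * ((√(n : ℝ))⁻¹ * |a|))) := by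
          gcongr
          exact hb z
      _ = D * E * C * |a| * Real.exp c * (√(n : ℝ) * (√(n : ℝ))⁻¹) *
          (Real.exp (c / 4 * |z|) * Real.exp (c / 4 * |z|) * Real.exp (-c * |z|)) := by ring
      _ = _ := by
          rw [← Real.exp_add, ← Real.exp_add, mul_inv_cancel₀ hspos.ne', mul_one]
          ring_nf
  · filter_upwards [h.ae_continuousAt] with z hz
    refine Tendsto.const_mul _ ?_
    -- Differentiating in `s`, with `s = 1 / √n`, rather than in the shift `s * a` includes the case
    -- `a = 0`.
    have hd : HasDerivAt (fun s : ℝ => g (z + s * a)) (a * gdot z) 0 := by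
      have h1 : HasDerivAt (fun s : ℝ => z + s * a) (1 * a) 0 :=
        ((hasDerivAt_id (0 : ℝ)).mul_const a).const_add z
      have h2 : HasDerivAt g (gdot z) (z + 0 * a) := by
        rw [zero_mul, add_zero]
        exact h.hasDerivAt hz
      convert! h2.comp (0 : ℝ) h1 using 1
      ring
    have hw : Tendsto (fun n : ℕ => (√(n : ℝ))⁻¹) atTop (𝓝[≠] 0) := by
      refine tendsto_nhdsWithin_iff.2 ⟨tendsto_inv_sqrt_natCast, ?_⟩
      filter_upwards [eventually_ge_atTop 1] with n hn
      exact (inv_pos.2 (Real.sqrt_pos.2 (by exact_mod_cast hn))).ne'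
    refine ((hasDerivAt_iff_tendsto_slope_zero.1 hd).comp hw).congr fun n => ?_
    simp

/-! ### The skewness score and its integrals. -/

/-- The summand `φ_f(z) (z² - κ(f))` of the skewness component of the central sequence. -/
noncomputable def skewScore (f fdot : ℝ → ℝ) (z : ℝ) : ℝ :=
  score f fdot z * (z ^ 2 - kappa f fdot)

theorem MemF1.measurable_skewScore (h : MemF1 f fdot) : Measurable (skewScore f fdot) :=
  h.monotone_score.measurable.mul ((measurable_id.pow_const 2).sub_const _)

theorem MemF1.subexpGrowth_skewScore (h : MemF1 f fdot) : SubexpGrowth (skewScore f fdot) := by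
  refine h.subexpGrowth_score.mul
    (SubexpGrowth.of_le_pow (C := 1 + |kappa f fdot|) (by positivity) 2 fun z => ?_)
  have h1 := abs_sub (z ^ 2) (kappa f fdot)
  rw [abs_of_nonneg (sq_nonneg z)] at h1
  have h2 := abs_nonneg z
  have h3 := abs_nonneg (kappa f fdot)
  nlinarith [sq_abs z, mul_nonneg h3 h2, mul_nonneg h3 (sq_nonneg |z|)]

theorem MemF1.ae_continuousAt_skewScore (h : MemF1 f fdot) :
    ∀ᵐ z, ContinuousAt (skewScore f fdot) z := by
  filter_upwards [h.ae_continuousAt] with z hz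
  exact hz.mul (by fun_prop)

theorem MemF1.ae_skewScore_neg (h : MemF1 f fdot) :
    ∀ᵐ z, skewScore f fdot (-z) = -skewScore f fdot z := by
  filter_upwards [h.ae_score_neg] with z hz
  simp only [skewScore, hz]
  ring

theorem integral_eq_zero_of_ae_odd {F : ℝ → ℝ} (hF : ∀ᵐ z, F (-z) = -F z) : ∫ z, F z = 0 := by
  have h1 : ∫ z, F (-z) = ∫ z, -F z := integral_congr_ae hF
  rw [integral_neg_eq_self, integral_neg] at h1
  linarith

/-- The substitution `y = r z` leaves an a.e. odd function of `y` times an even one. -/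
theorem MemF1.integral_skewScore_mul_eq_zero (hf : MemF1 f fdot) (hg : MemF1 g gdot) {r : ℝ}
    (hr : r ≠ 0) : ∫ z, skewScore f fdot (r * z) * g z = 0 := by
  have h1 := Measure.integral_comp_mul_left (fun y => skewScore f fdot y * g (y / r)) r
  simp only [mul_div_cancel_left₀ _ hr] at h1
  rw [h1, integral_eq_zero_of_ae_odd, smul_zero]
  filter_upwards [hf.ae_skewScore_neg] with z hz
  rw [hz, neg_div, hg.symm, neg_mul]

theorem MemFCross.integral_skewScore_mul_deriv (hf : MemF1 f fdot) (hg : MemFCross f fdot g gdot)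
    (a : ℝ) : ∫ z, skewScore f fdot z * (a * gdot z)
      = -(a * (crossJ f fdot g gdot - kappa f fdot * crossI f fdot g gdot)) := by
  obtain ⟨iI, iJ⟩ := hg.integrable_cross hf
  rw [crossJ, crossI, ← integral_const_mul, ← integral_sub iJ (iI.const_mul _),
    ← integral_const_mul, ← integral_neg]
  congr with z
  rw [hg.memF1.fdot_eq, skewScore]
  ring

theorem Delta3_sub (n : ℕ) {θ σ θ' σ' r d : ℝ}
    (hrd : ∀ x, stdObs θ' σ' x = r * stdObs θ σ x + d) (x : Fin n → ℝ) :
    Delta3 f fdot n θ' σ' x - Delta3 f fdot n θ σ x = (√(n : ℝ))⁻¹ * ∑ i,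
      (skewScore f fdot (r * stdObs θ σ (x i) + d) - skewScore f fdot (stdObs θ σ (x i))) := by
  simp only [Delta3, Finset.sum_sub_distrib, mul_sub, hrd, skewScore]

/-! ### Asymptotic linearity. -/

/-- Asymptotic linearity of the skewness component under affine perturbations of the
standardization. -/
theorem MemF1.isLittleOP_Delta3_sub (hf : MemF1 f fdot) (hg : MemF1 g gdot) {θ σ : ℝ} (hσ : 0 < σ)
    {θ' σ' r d : ℕ → ℝ} {m : ℝ}
    (hrd : ∀ n x, stdObs (θ' n) (σ' n) x = r n * stdObs θ σ x + d n)
    (hr : Tendsto r atTop (𝓝 1)) (hd : Tendsto d atTop (𝓝 0))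
    (hm : Tendsto (fun n : ℕ => √(n : ℝ) *
      ∫ z, (skewScore f fdot (r n * z + d n) - skewScore f fdot z) * g z) atTop (𝓝 m)) :
    IsLittleOP (fun n => nullLaw n θ σ g)
      (fun n x => Delta3 f fdot n (θ' n) (σ' n) x - Delta3 f fdot n θ σ x - m) := by
  have hmeas := hf.measurable_skewScore
  have hsub := hf.subexpGrowth_skewScore
  simp_rw [fun n => Delta3_sub (f := f) (fdot := fdot) n (hrd n)]
  refine hg.isLittleOP_nullLaw hσ
    (K := fun n z => skewScore f fdot (r n * z + d n) - skewScore f fdot z)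
    (fun n => by fun_prop) (fun n => ?_)
    (hg.tendsto_integral_sq_increment hmeas hsub hf.ae_continuousAt_skewScore hr hd) hm
  have hK := (hsub.comp_affine (r n) (d n)).sub hsub
  simp_rw [pow_two]
  exact hg.integrable_mul (by fun_prop) (hK.mul hK)

end SymmetryTest

theorem propositionA1 (f₁ fdot₁ g₁ gdot₁ : ℝ → ℝ)
    (hf : SymmetryTest.MemF1 f₁ fdot₁) (hg : SymmetryTest.MemFCross f₁ fdot₁ g₁ gdot₁)
    (θ σ : ℝ) (hσ : 0 < σ) :
    (∀ t : ℝ, SymmetryTest.IsLittleOP (fun n => SymmetryTest.nullLaw n θ σ g₁)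
      (fun n x =>
        SymmetryTest.Delta3 f₁ fdot₁ n (θ + (√(n : ℝ))⁻¹ * t) σ x
          - (SymmetryTest.Delta3 f₁ fdot₁ n θ σ x
            - t * σ⁻¹ * (SymmetryTest.crossJ f₁ fdot₁ g₁ gdot₁
              - SymmetryTest.kappa f₁ fdot₁ * SymmetryTest.crossI f₁ fdot₁ g₁ gdot₁)))) ∧
    (∀ s : ℝ, SymmetryTest.IsLittleOP (fun n => SymmetryTest.nullLaw n θ σ g₁)
      (fun n x =>
        SymmetryTest.Delta3 f₁ fdot₁ n θ (σ + (√(n : ℝ))⁻¹ * s) x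
          - SymmetryTest.Delta3 f₁ fdot₁ n θ σ x)) := by
  have hδ : ∀ a : ℝ, Tendsto (fun n : ℕ => (√(n : ℝ))⁻¹ * a) atTop (𝓝 0) := fun a => by
    simpa using SymmetryTest.tendsto_inv_sqrt_natCast.mul_const a
  refine ⟨fun t => ?_, fun s => ?_⟩
  · have hm := hg.memF1.tendsto_sqrt_mul_integral_shift hf.measurable_skewScore
      hf.subexpGrowth_skewScore (t * σ⁻¹)
    rw [hg.integral_skewScore_mul_deriv hf] at hm
    have key := hf.isLittleOP_Delta3_sub hg.memF1 hσ (θ := θ)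
      (θ' := fun n => θ + (√(n : ℝ))⁻¹ * t) (σ' := fun _ => σ) (r := fun _ => 1)
      (d := fun n => -((√(n : ℝ))⁻¹ * (t * σ⁻¹)))
      (fun n x => by simp only [SymmetryTest.stdObs]; ring) tendsto_const_nhds
      (by simpa using (hδ (t * σ⁻¹)).neg) hm
    convert! key using 3
    ring
  · have hlim : Tendsto (fun n : ℕ => σ * (σ + (√(n : ℝ))⁻¹ * s)⁻¹) atTop (𝓝 1) := by
      have h1 : Tendsto (fun n : ℕ => σ + (√(n : ℝ))⁻¹ * s) atTop (𝓝 σ) := by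
        simpa using (hδ s).const_add σ
      simpa [hσ.ne'] using (h1.inv₀ hσ.ne').const_mul σ
    have key := hf.isLittleOP_Delta3_sub hg.memF1 hσ (θ := θ) (m := 0)
      (θ' := fun _ => θ) (σ' := fun n => σ + (√(n : ℝ))⁻¹ * s)
      (r := fun n => σ * (σ + (√(n : ℝ))⁻¹ * s)⁻¹) (d := fun _ => 0)
      -- This identity holds even if the perturbed scale vanishes, because then both sides are zero.
      (fun n x => by
        simp only [SymmetryTest.stdObs]
        rw [add_zero, mul_comm σ, mul_assoc, mul_inv_cancel_left₀ hσ.ne']) hlim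
      tendsto_const_nhds (by
        refine tendsto_const_nhds.congr' ?_
        -- The perturbed scale may vanish for small `n`; once the ratio is nonzero, both integrals
        -- are zero by oddness.
        filter_upwards [hlim.eventually_ne one_ne_zero] with n hn
        have hint : ∀ r, MeasureTheory.Integrable
            fun z => SymmetryTest.skewScore f₁ fdot₁ (r * z) * g₁ z := fun r => by
          have hmeas := hf.measurable_skewScore
          have := hf.subexpGrowth_skewScore.comp_affine r 0
          simp only [add_zero] at this
          exact hg.memF1.integrable_mul (by fun_prop) this
        have h0 := hf.integral_skewScore_mul_eq_zero hg.memF1 hn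
        have h1 := hf.integral_skewScore_mul_eq_zero hg.memF1 one_ne_zero
        have i1 := hint 1
        simp only [one_mul] at h1 i1
        simp_rw [add_zero, sub_mul]
        rw [MeasureTheory.integral_sub (hint _) i1, h0, h1, sub_zero, mul_zero])
    simpa only [sub_zero] using key
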